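/- A polynomial knot is a smooth embedding $\kappa:\mathbb R\to\mathbb R^3$ whose components are polynomials; its degree $d$ is the maximum of the degrees of its components. Such a $\kappa$ extends to an embedding $\bar\kappa$ of the circle $S^1=\mathbb R\cup\{\infty\}$ in $S^3=\mathbb R^3\cup\{\infty\}$ with $\bar\kappa(\infty)=\infty$. Two embeddings $\alpha_0,\alpha_1:S^1\to S^3$ have the same knot type if $\alpha_0=g\circ\alpha_1\circ f$ for orientation-preserving homeomorphisms $f$ of $S^1$ and $g$ of $S^3$. The bridge number $b$ of $\kappa$ is the minimum number of local maxima of $K'$ in the direction $v$ (that is, of the function $\langle v,\cdot\rangle$ along $K'$), over all embedded closed curves $K':S^1\to\mathbb R^3\subset S^3$ with the same knot type as $\bar\kappa$ and all directions $v\neq 0$. Proposition. If $\kappa$ is a polynomial knot of degree $d\ge 3$, then its bridge number $b$ is finite and $$ b\le \tfrac12(d-1). $$ -/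

import Mathlib

open Polynomial Filter Topology CategoryTheory

noncomputable section

/-- Real Euclidean `n`-space. -/
abbrev EucSpace (n : ℕ) : Type := EuclideanSpace ℝ (Fin n)

/-- The `n`-sphere, as the one-point compactification of Euclidean `n`-space. -/
abbrev SphereOf (n : ℕ) : Type := OnePoint (EucSpace n)

/-- The circle, as the one-point compactification of the real line. -/
abbrev CircleOf : Type := OnePoint ℝ

/-- A homeomorphism `h` of a space `X` (an oriented `n`-sphere) is orientation preserving if it
induces the identity on the `n`-th singular homology group `H_n(X; ℤ)`, that is, has degree `1`. -/
def IsOrientationPreserving (n : ℕ) {X : Type} [TopologicalSpace X] (h : X ≃ₜ X) : Prop :=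
  ((AlgebraicTopology.singularHomologyFunctor (ModuleCat.{0} ℤ) n).obj
      (ModuleCat.of ℤ ℤ)).map (TopCat.ofHom (h : C(X, X))) = 𝟙 _

/-- A topological knot: a continuous embedding of the circle in the `n`-sphere. -/
structure TopKnot (n : ℕ) where
  toFun : CircleOf → SphereOf n
  isEmbedding : IsEmbedding toFun

/-- Two topological knots have the same knot type if they differ by orientation-preserving
homeomorphisms of the circle and of the sphere. -/
def TopKnot.Equivalent {n : ℕ} (K₀ K₁ : TopKnot n) : Prop :=
  ∃ (f : CircleOf ≃ₜ CircleOf) (g : SphereOf n ≃ₜ SphereOf n),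
    IsOrientationPreserving 1 f ∧ IsOrientationPreserving n g ∧
      K₀.toFun = g ∘ K₁.toFun ∘ f

/-- A closed knot that lies in Euclidean `n`-space. -/
structure SpaceKnot (n : ℕ) where
  toFun : CircleOf → EucSpace n
  isEmbedding : IsEmbedding toFun

/-- A closed knot in Euclidean space, regarded as a knot in the sphere. -/
def SpaceKnot.toTopKnot {n : ℕ} (K : SpaceKnot n) : TopKnot n where
  toFun s := (K.toFun s : SphereOf n)
  isEmbedding := OnePoint.isOpenEmbedding_coe.isEmbedding.comp K.isEmbedding

/-- The number (possibly infinite) of local maxima of a closed knot in the direction `v`. -/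
def SpaceKnot.numLocalMax {n : ℕ} (K : SpaceKnot n) (v : EucSpace n) : ℕ∞ :=
  {s : CircleOf | IsLocalMax (fun s => inner ℝ v (K.toFun s)) s}.encard

/-- The bridge number of a topological knot `K` in the three-sphere: the minimum number of local
maxima of `K'` in the direction `v`, over all `K'` in three-space with the same knot type as `K`
and all directions `v`. (It is `⊤` if every such number is infinite.) -/
def TopKnot.bridgeNumber (K : TopKnot 3) : ℕ∞ :=
  ⨅ (K' : SpaceKnot 3) (_ : K'.toTopKnot.Equivalent K) (v : EucSpace 3) (_ : v ≠ 0),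
    K'.numLocalMax v

/-- The parametrized curve in Euclidean `n`-space with the given polynomial components. -/
def polyCurve {n : ℕ} (p : Fin n → ℝ[X]) (t : ℝ) : EucSpace n :=
  WithLp.toLp 2 fun i => (p i).eval t

/-- A polynomial knot: a smooth embedding of the line in Euclidean `n`-space (a topological
embedding with nowhere vanishing derivative) whose components are polynomials. -/
structure PolyKnot (n : ℕ) where
  comp : Fin n → ℝ[X]
  isEmbedding : IsEmbedding (polyCurve comp)
  deriv_ne_zero : ∀ t : ℝ, deriv (polyCurve comp) t ≠ 0

/-- The degree of a polynomial knot: the maximum of the degrees of its components. -/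
def PolyKnot.degree {n : ℕ} (κ : PolyKnot n) : ℕ :=
  Finset.univ.sup fun i => (κ.comp i).natDegree

theorem PolyKnot.tendsto_cocompact {n : ℕ} (κ : PolyKnot n) :
    Tendsto (polyCurve κ.comp) (cocompact ℝ) (cocompact (EucSpace n)) := by
  obtain ⟨i, hi⟩ : ∃ i, 0 < (κ.comp i).degree := by
    by_contra! h
    have h01 : polyCurve κ.comp 0 = polyCurve κ.comp 1 := by
      unfold polyCurve
      congr 1
      funext i
      rw [Polynomial.eq_C_of_degree_le_zero (h i)]
      simp
    exact zero_ne_one (κ.isEmbedding.injective h01)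
  refine tendsto_cocompact_of_tendsto_dist_comp_atTop 0 ?_
  have key : Tendsto (fun t : ℝ => ‖(κ.comp i).eval t‖) (cocompact ℝ) atTop :=
    Polynomial.tendsto_norm_atTop (κ.comp i) hi tendsto_norm_cocompact_atTop
  refine tendsto_atTop_mono (fun t => ?_) key
  rw [dist_zero_right]
  exact PiLp.norm_apply_le (polyCurve κ.comp t) i

/-- The one-point compactification of a polynomial knot, which sends `∞` to `∞`. -/
def PolyKnot.completion {n : ℕ} (κ : PolyKnot n) : TopKnot n where
  toFun := OnePoint.map (polyCurve κ.comp)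
  isEmbedding := by
    refine (Continuous.isClosedEmbedding ?_ ?_).isEmbedding
    · refine OnePoint.continuous_map κ.isEmbedding.continuous ?_
      simpa only [coclosedCompact_eq_cocompact] using κ.tendsto_cocompact
    · exact Option.map_injective κ.isEmbedding.injective

end

/-!
The height of a polynomial curve in the direction `v` is a polynomial depending linearly on `v`.
The directions form a space of dimension three, so some `v ≠ 0` kills the coefficients of `t ^ d`
and `t ^ (d - 1)`, and the height `P` has degree `m ≤ d - 2`. If `m > 0` and the leading coefficient
is positive, two consecutive local maxima of `P`, as well as the last one and `+∞`, enclose a local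
minimum, hence `P` has at most `(m - 1) / 2` local maxima.

It remains to pull the point at infinity into space at the cost of one more local maximum. If both
ends of the curve rise, an affine map in each horizontal slice makes them diagonal near infinity,
and there a conjugate of a small translation by the inversion preserves the order of the heights.
If one end falls, a slicewise translation first makes the rising end vertical and the falling end
diagonal, and a shear that vanishes near the axis turns the latter upwards. If the height is
constant, the curve is closed in a plane, so by Tietze's theorem a shear turns its height into `t`.
All these homeomorphisms of the sphere are homotopic to the identity, hence preserve orientation.
-/

noncomputable section

section Orientation

variable {X Y : Type*} [TopologicalSpace X] [TopologicalSpace Y]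

/-- A self-homeomorphism that is homotopic to the identity through continuous maps, which need not
be homeomorphisms. This is how orientation preservation is checked. -/
def HomotopicToId (h : X ≃ₜ X) : Prop :=
  (h : C(X, X)).Homotopic (ContinuousMap.id X)

theorem homotopicToId_refl : HomotopicToId (Homeomorph.refl X) :=
  ContinuousMap.Homotopic.refl _

theorem HomotopicToId.trans {g h : X ≃ₜ X} (hg : HomotopicToId g) (hh : HomotopicToId h) :
    HomotopicToId (g.trans h) :=
  ContinuousMap.Homotopic.comp hh hg

theorem HomotopicToId.conj {h : Y ≃ₜ Y} (hh : HomotopicToId h) (e : X ≃ₜ Y) :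
    HomotopicToId ((e.trans h).trans e.symm) := by
  have key := (ContinuousMap.Homotopic.refl (e.symm : C(Y, X))).comp
    (hh.comp (ContinuousMap.Homotopic.refl (e : C(X, Y))))
  have hid : (e.symm : C(Y, X)).comp ((ContinuousMap.id Y).comp (e : C(X, Y)))
      = ContinuousMap.id X := by
    ext x; simp
  rwa [hid] at key

theorem HomotopicToId.isOrientationPreserving {X : Type} [TopologicalSpace X] {h : X ≃ₜ X}
    (hh : HomotopicToId h) (n : ℕ) : IsOrientationPreserving n h := by
  obtain ⟨H⟩ := hh
  have H' : TopCat.Homotopy (TopCat.ofHom (h : C(X, X))) (𝟙 (TopCat.of X)) := H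
  exact (H'.congr_homologyMap_singularChainComplexFunctor (ModuleCat.of ℤ ℤ) n).trans
    (CategoryTheory.Functor.map_id
      ((AlgebraicTopology.singularHomologyFunctor (ModuleCat.{0} ℤ) n).obj (ModuleCat.of ℤ ℤ)) _)

theorem cocompact_prod_of_compactSpace [CompactSpace Y] :
    cocompact (Y × X) = comap Prod.snd (cocompact X) := by
  rw [← coprod_cocompact, cocompact_eq_bot, bot_coprod]

variable [T2Space X] {h : X ≃ₜ X}

theorem homotopicToId_onePointCongr (F : C(unitInterval × X, X))
    (hF : Tendsto F (cocompact (unitInterval × X)) (cocompact X))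
    (h0 : ∀ x, F (0, x) = h x) (h1 : ∀ x, F (1, x) = x) : HomotopicToId h.onePointCongr := by
  have hmap (s : unitInterval) (l : Filter X) : 𝓝 s ×ˢ map ((↑) : X → OnePoint X) l
      = map (Prod.map id (↑)) (𝓝 s ×ˢ l) := by
    rw [← prod_map_map_eq', map_id]
  have hcont : Continuous fun q : unitInterval × OnePoint X =>
      OnePoint.map (fun x => F (q.1, x)) q.2 := by
    rw [continuous_iff_continuousAt]
    rintro ⟨s, x⟩
    rw [ContinuousAt, nhds_prod_eq]
    induction x using OnePoint.rec with
    | infty =>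
      rw [OnePoint.nhds_infty_eq, prod_sup, OnePoint.map_infty, hmap, coclosedCompact_eq_cocompact]
      refine Tendsto.sup (tendsto_map'_iff.2 ?_) ?_
      · rw [cocompact_prod_of_compactSpace] at hF
        have hinfty : Tendsto ((↑) : X → OnePoint X) (cocompact X) (𝓝 OnePoint.infty) := by
          simpa only [coclosedCompact_eq_cocompact] using OnePoint.tendsto_coe_infty (X := X)
        exact hinfty.comp (hF.mono_left (inf_le_right : 𝓝 s ×ˢ cocompact X ≤ _))
      · rw [prod_pure, tendsto_map'_iff]
        exact tendsto_const_nhds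
    | coe x =>
      rw [OnePoint.nhds_coe_eq, hmap, tendsto_map'_iff, ← nhds_prod_eq]
      exact (OnePoint.continuous_coe.comp F.continuous).continuousAt
  refine ⟨⟨⟨_, hcont⟩, ?_, ?_⟩⟩
  · rintro (_ | x)
    exacts [rfl, congrArg _ (h0 x)]
  · rintro (_ | x)
    exacts [rfl, congrArg _ (h1 x)]

theorem homotopicToId_onePointCongr_of_leftInverse (F G : C(unitInterval × X, X))
    (hGF : ∀ s x, G (s, F (s, x)) = x) (h0 : ∀ x, F (0, x) = h x) (h1 : ∀ x, F (1, x) = x) :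
    HomotopicToId h.onePointCongr := by
  refine homotopicToId_onePointCongr F ?_ h0 h1
  have hemb : IsClosedEmbedding fun q : unitInterval × X => (q.1, F q) :=
    Function.LeftInverse.isClosedEmbedding (f := fun q => (q.1, G q))
      (fun q => Prod.ext rfl (hGF q.1 q.2)) (by fun_prop) (by fun_prop)
  have := hemb.tendsto_cocompact
  rw [cocompact_prod_of_compactSpace, tendsto_comap_iff] at this
  rwa [cocompact_prod_of_compactSpace]

theorem homotopicToId_onePointCongr_of_norm_sub_le {V : Type*} [NormedAddCommGroup V]
    [NormedSpace ℝ V] [ProperSpace V] {h : V ≃ₜ V} {C : ℝ} (hC : ∀ x, ‖h x - x‖ ≤ C) :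
    HomotopicToId h.onePointCongr := by
  let F : C(unitInterval × V, V) := ⟨fun q => q.2 + (1 - (q.1 : ℝ)) • (h q.2 - q.2), by fun_prop⟩
  have hF (q : unitInterval × V) : ‖q.2‖ - C ≤ ‖F q‖ := by
    have hs : ‖(1 - (q.1 : ℝ)) • (h q.2 - q.2)‖ ≤ C := by
      rw [norm_smul, Real.norm_of_nonneg (sub_nonneg.2 q.1.2.2)]
      exact (mul_le_of_le_one_left (norm_nonneg _) (sub_le_self _ q.1.2.1)).trans (hC _)
    have := norm_le_add_norm_add q.2 ((1 - (q.1 : ℝ)) • (h q.2 - q.2))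
    change ‖q.2‖ - C ≤ ‖q.2 + (1 - (q.1 : ℝ)) • (h q.2 - q.2)‖
    linarith
  refine homotopicToId_onePointCongr F ?_ (by simp [F]) (by simp [F])
  rw [cocompact_prod_of_compactSpace]
  refine tendsto_cocompact_of_tendsto_dist_comp_atTop 0 ?_
  simp only [dist_zero_right]
  refine tendsto_atTop_mono hF (tendsto_atTop_add_const_right _ _ ?_)
  exact (tendsto_norm_cocompact_atTop (E := V)).comp tendsto_comap

end Orientation

section Inversion

variable {V : Type*} [NormedAddCommGroup V] [NormedSpace ℝ V]

/-- Inversion in the unit sphere of a normed space, with the junk value `0` at `0`. -/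
def unitInversion (x : V) : V :=
  ‖x‖⁻¹ ^ 2 • x

theorem norm_unitInversion (x : V) : ‖unitInversion x‖ = ‖x‖⁻¹ := by
  rcases eq_or_ne x 0 with rfl | hx
  · simp [unitInversion]
  · have := norm_ne_zero_iff.2 hx
    rw [unitInversion, norm_smul, norm_pow, norm_inv, norm_norm]
    field_simp

theorem unitInversion_eq_zero {x : V} : unitInversion x = 0 ↔ x = 0 := by
  rw [← norm_eq_zero, norm_unitInversion, inv_eq_zero, norm_eq_zero]

theorem unitInversion_involutive : Function.Involutive (unitInversion (V := V)) := by
  intro x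
  rcases eq_or_ne x 0 with rfl | hx
  · simp [unitInversion]
  · have := norm_ne_zero_iff.2 hx
    rw [unitInversion, norm_unitInversion, unitInversion, smul_smul, inv_inv, ← mul_pow,
      mul_inv_cancel₀ this, one_pow, one_smul]

theorem continuousAt_unitInversion {x : V} (hx : x ≠ 0) : ContinuousAt unitInversion x :=
  ((continuous_norm.continuousAt.inv₀ (norm_ne_zero_iff.2 hx)).pow 2).smul continuousAt_id

theorem tendsto_unitInversion_cocompact [ProperSpace V] :
    Tendsto unitInversion (cocompact V) (𝓝 0) := by
  rw [tendsto_zero_iff_norm_tendsto_zero]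
  simp only [norm_unitInversion]
  exact tendsto_inv_atTop_zero.comp (tendsto_norm_cocompact_atTop (E := V))

theorem tendsto_unitInversion_nhdsNE_zero [ProperSpace V] :
    Tendsto unitInversion (𝓝[≠] (0 : V)) (cocompact V) := by
  refine tendsto_cocompact_of_tendsto_dist_comp_atTop 0 ?_
  simp only [dist_zero_right, norm_unitInversion]
  exact tendsto_inv_nhdsGT_zero.comp (tendsto_norm_nhdsNE_zero (E := V))

open Classical in
/-- Inversion in the unit sphere on the one-point compactification, which exchanges `0` and `∞`. -/
def extendedInversion : OnePoint V → OnePoint V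
  | OnePoint.infty => ((0 : V) : OnePoint V)
  | OnePoint.some x => if x = 0 then OnePoint.infty else ((unitInversion x : V) : OnePoint V)

theorem extendedInversion_infty : extendedInversion (OnePoint.infty : OnePoint V) = (0 : V) :=
  rfl

theorem extendedInversion_zero : extendedInversion ((0 : V) : OnePoint V) = OnePoint.infty :=
  if_pos rfl

theorem extendedInversion_coe {x : V} (hx : x ≠ 0) :
    extendedInversion (x : OnePoint V) = ((unitInversion x : V) : OnePoint V) :=
  if_neg hx

theorem extendedInversion_involutive : Function.Involutive (extendedInversion (V := V)) := by
  intro x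
  induction x using OnePoint.rec with
  | infty => rw [extendedInversion_infty, extendedInversion_zero]
  | coe x =>
    rcases eq_or_ne x 0 with rfl | hx
    · rw [extendedInversion_zero, extendedInversion_infty]
    · rw [extendedInversion_coe hx, extendedInversion_coe (unitInversion_eq_zero.not.2 hx),
        unitInversion_involutive]

theorem continuousAt_extendedInversion_infty [ProperSpace V] :
    ContinuousAt extendedInversion (OnePoint.infty : OnePoint V) := by
  rw [OnePoint.continuousAt_infty', coclosedCompact_eq_cocompact, extendedInversion_infty]
  refine ((OnePoint.continuous_coe.tendsto (0 : V)).comp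
    tendsto_unitInversion_cocompact).congr' ?_
  have hnorm : ∀ᶠ x in cocompact V, 0 < ‖x‖ :=
    (tendsto_norm_cocompact_atTop (E := V)).eventually_gt_atTop 0
  filter_upwards [hnorm] with x hx
  exact (extendedInversion_coe (norm_pos_iff.1 hx)).symm

theorem continuousAt_extendedInversion_zero [ProperSpace V] :
    ContinuousAt extendedInversion ((0 : V) : OnePoint V) := by
  rw [OnePoint.continuousAt_coe, ContinuousAt, ← nhdsNE_sup_pure, Function.comp_apply,
    extendedInversion_zero]
  refine Tendsto.sup ?_ ?_
  · have hinv := tendsto_unitInversion_nhdsNE_zero (V := V)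
    rw [← coclosedCompact_eq_cocompact] at hinv
    refine (OnePoint.tendsto_coe_infty.comp hinv).congr' ?_
    filter_upwards [self_mem_nhdsWithin] with x hx
    exact (extendedInversion_coe hx).symm
  · refine (tendsto_pure_nhds _ _).mono_right ?_
    rw [Function.comp_apply, extendedInversion_zero]

theorem continuousAt_extendedInversion_coe {x : V} (hx : x ≠ 0) :
    ContinuousAt extendedInversion (x : OnePoint V) := by
  rw [OnePoint.continuousAt_coe]
  refine (OnePoint.continuous_coe.continuousAt.comp (continuousAt_unitInversion hx)).congr ?_
  filter_upwards [isOpen_ne.mem_nhds hx] with y hy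
  exact (extendedInversion_coe hy).symm

theorem continuous_extendedInversion [ProperSpace V] :
    Continuous (extendedInversion (V := V)) := by
  rw [continuous_iff_continuousAt]
  intro x
  induction x using OnePoint.rec with
  | infty => exact continuousAt_extendedInversion_infty
  | coe x =>
    rcases eq_or_ne x 0 with rfl | hx
    exacts [continuousAt_extendedInversion_zero, continuousAt_extendedInversion_coe hx]

/-- `extendedInversion` as a homeomorphism. -/
def inversionHomeomorph [ProperSpace V] : OnePoint V ≃ₜ OnePoint V where
  toEquiv := extendedInversion_involutive.toPerm
  continuous_toFun := continuous_extendedInversion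
  continuous_invFun := continuous_extendedInversion

end Inversion

section DragInfinity

variable {V : Type*} [NormedAddCommGroup V] [NormedSpace ℝ V]

/-- The map that moves the centre of the unit ball to `c` and fixes the complement of the ball. -/
def ballShift (c x : V) : V :=
  x + max 0 (1 - ‖x‖) • c

theorem ballShift_zero (c : V) : ballShift c 0 = c := by
  simp [ballShift]

theorem ballShift_of_one_le_norm (c : V) {x : V} (hx : 1 ≤ ‖x‖) : ballShift c x = x := by
  simp [ballShift, hx]

theorem norm_ballShift_sub_le (c x : V) : ‖ballShift c x - x‖ ≤ ‖c‖ := by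
  have hcoef : max 0 (1 - ‖x‖) ≤ 1 := max_le zero_le_one (sub_le_self _ (norm_nonneg x))
  rw [ballShift, add_sub_cancel_left, norm_smul, Real.norm_of_nonneg (le_max_left _ _)]
  exact mul_le_of_le_one_left (norm_nonneg c) hcoef

theorem approximatesLinearOn_ballShift (c : V) :
    ApproximatesLinearOn (ballShift c) (ContinuousLinearEquiv.refl ℝ V : V →L[ℝ] V)
      Set.univ ‖c‖₊ := by
  intro x _ y _
  have hdiff : ballShift c x - ballShift c y - (x - y)
      = (max 0 (1 - ‖x‖) - max 0 (1 - ‖y‖)) • c := by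
    simp only [ballShift, sub_smul]
    abel
  have hcoef : |max 0 (1 - ‖x‖) - max 0 (1 - ‖y‖)| ≤ ‖x - y‖ := by
    refine (abs_max_sub_max_le_max _ _ _ _).trans (max_le (by simp) ?_)
    rw [sub_sub_sub_cancel_left, norm_sub_rev]
    exact abs_norm_sub_norm_le y x
  rw [ContinuousLinearEquiv.coe_refl, ContinuousLinearMap.coe_id', id_eq, hdiff, norm_smul,
    mul_comm, coe_nnnorm]
  exact mul_le_mul_of_nonneg_left hcoef (norm_nonneg c)

variable [ProperSpace V] {c : V} (hc : ‖c‖ < 1)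

/-- `ballShift c` as a homeomorphism: it is a small Lipschitz perturbation of the identity. -/
def ballShiftHomeomorph : V ≃ₜ V :=
  (approximatesLinearOn_ballShift c).toHomeomorph (ballShift c) <| by
    rcases subsingleton_or_nontrivial V with hV | hV
    · exact Or.inl hV
    · refine Or.inr ?_
      have hrefl : ‖((ContinuousLinearEquiv.refl ℝ V).symm : V →L[ℝ] V)‖₊ = 1 :=
        NNReal.eq (ContinuousLinearMap.norm_id (𝕜 := ℝ) (E := V))
      rw [hrefl, inv_one]
      exact hc

theorem homotopicToId_ballShiftHomeomorph :
    HomotopicToId (ballShiftHomeomorph hc).onePointCongr :=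
  homotopicToId_onePointCongr_of_norm_sub_le (norm_ballShift_sub_le c)

/-- The homeomorphism of the one-point compactification that fixes the unit ball and moves the
point at infinity to the inverse of `c`. -/
def dragInfinity : OnePoint V ≃ₜ OnePoint V :=
  (inversionHomeomorph.trans (ballShiftHomeomorph hc).onePointCongr).trans inversionHomeomorph.symm

theorem homotopicToId_dragInfinity : HomotopicToId (dragInfinity hc) :=
  (homotopicToId_ballShiftHomeomorph hc).conj _

theorem dragInfinity_apply (x : OnePoint V) : dragInfinity hc x
    = extendedInversion (OnePoint.map (ballShift c) (extendedInversion x)) :=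
  rfl

theorem dragInfinity_infty (h0 : c ≠ 0) :
    dragInfinity hc OnePoint.infty = ((unitInversion c : V) : OnePoint V) := by
  rw [dragInfinity_apply, extendedInversion_infty, OnePoint.map_some, ballShift_zero,
    extendedInversion_coe h0]

theorem dragInfinity_of_norm_le_one {x : V} (hx : ‖x‖ ≤ 1) : dragInfinity hc x = x := by
  rcases eq_or_ne x 0 with rfl | h0
  · rw [dragInfinity_apply, extendedInversion_zero, OnePoint.map_infty, extendedInversion_infty]
  · have hnorm : 1 ≤ ‖unitInversion x‖ := by
      rw [norm_unitInversion]
      exact (one_le_inv₀ (norm_pos_iff.2 h0)).2 hx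
    rw [dragInfinity_apply, extendedInversion_coe h0, OnePoint.map_some,
      ballShift_of_one_le_norm c hnorm, ← extendedInversion_coe h0, extendedInversion_involutive]

theorem dragInfinity_coe {x : V} (hx : x ≠ 0) (h0 : ballShift c (unitInversion x) ≠ 0) :
    dragInfinity hc x
      = ((unitInversion (ballShift c (unitInversion x)) : V) : OnePoint V) := by
  rw [dragInfinity_apply, extendedInversion_coe hx, OnePoint.map_some, extendedInversion_coe h0]

end DragInfinity

section AmbientMaps

variable {V : Type*} [NormedAddCommGroup V] [NormedSpace ℝ V]

theorem lineMap_pos {a : ℝ} (ha : 0 < a) (s : unitInterval) : 0 < (1 - (s : ℝ)) * a + s := by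
  have h0 := s.2.1
  have h1 := s.2.2
  rcases h0.eq_or_lt with hs | hs
  · rw [← hs]; linarith
  · have := mul_nonneg (sub_nonneg.2 h1) ha.le
    linarith

theorem homotopicToId_smul {a : ℝ} (ha : 0 < a) :
    HomotopicToId (Homeomorph.smulOfNeZero a ha.ne' : V ≃ₜ V).onePointCongr := by
  have hpos := lineMap_pos ha
  have hinv : Continuous fun s : unitInterval => ((1 - (s : ℝ)) * a + s)⁻¹ :=
    Continuous.inv₀ (by fun_prop) fun s => (hpos s).ne'
  refine homotopicToId_onePointCongr_of_leftInverse
    ⟨fun q => ((1 - (q.1 : ℝ)) * a + q.1) • q.2, by fun_prop⟩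
    ⟨fun q => ((1 - (q.1 : ℝ)) * a + q.1)⁻¹ • q.2, (hinv.comp continuous_fst).smul continuous_snd⟩
    ?_ ?_ ?_
  · exact fun s x => inv_smul_smul₀ (hpos s).ne' x
  · simp
  · simp

/-- The homeomorphism that acts on the slice at height `z` by `w ↦ u z • (w - m z)`. -/
def sliceAffine (m : C(ℝ, V)) (u : C(ℝ, ℝ)) (hu : ∀ z, 0 < u z) : V × ℝ ≃ₜ V × ℝ where
  toFun q := (u q.2 • (q.1 - m q.2), q.2)
  invFun q := ((u q.2)⁻¹ • q.1 + m q.2, q.2)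
  left_inv q := by simp [inv_smul_smul₀ (hu q.2).ne']
  right_inv q := by simp [smul_inv_smul₀ (hu q.2).ne']
  continuous_toFun := by fun_prop
  continuous_invFun := by
    have : Continuous fun q : V × ℝ => (u q.2)⁻¹ :=
      Continuous.inv₀ (by fun_prop) fun q => (hu q.2).ne'
    fun_prop

theorem sliceAffine_apply (m : C(ℝ, V)) (u : C(ℝ, ℝ)) (hu : ∀ z, 0 < u z) (q : V × ℝ) :
    sliceAffine m u hu q = (u q.2 • (q.1 - m q.2), q.2) :=
  rfl

theorem homotopicToId_sliceAffine (m : C(ℝ, V)) (u : C(ℝ, ℝ)) (hu : ∀ z, 0 < u z) :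
    HomotopicToId (sliceAffine m u hu).onePointCongr := by
  have hpos (s : unitInterval) (z : ℝ) := lineMap_pos (hu z) s
  have hinv : Continuous fun q : unitInterval × V × ℝ =>
      ((1 - (q.1 : ℝ)) * u q.2.2 + q.1)⁻¹ :=
    Continuous.inv₀ (by fun_prop) fun q => (hpos q.1 q.2.2).ne'
  refine homotopicToId_onePointCongr_of_leftInverse
    ⟨fun q => (((1 - (q.1 : ℝ)) * u q.2.2 + q.1) • (q.2.1 - (1 - (q.1 : ℝ)) • m q.2.2), q.2.2),
      by fun_prop⟩
    ⟨fun q => (((1 - (q.1 : ℝ)) * u q.2.2 + q.1)⁻¹ • q.2.1 + (1 - (q.1 : ℝ)) • m q.2.2, q.2.2),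
      by fun_prop⟩ ?_ ?_ ?_
  · intro s q
    simp [inv_smul_smul₀ (hpos s q.2).ne']
  · simp [sliceAffine_apply]
  · simp

/-- The shear `(w, z) ↦ (w, z + F w)`. -/
def verticalShear {X : Type*} [TopologicalSpace X] (F : C(X, ℝ)) : X × ℝ ≃ₜ X × ℝ where
  toFun q := (q.1, q.2 + F q.1)
  invFun q := (q.1, q.2 - F q.1)
  left_inv q := by simp
  right_inv q := by simp
  continuous_toFun := by fun_prop
  continuous_invFun := by fun_prop

theorem verticalShear_apply {X : Type*} [TopologicalSpace X] (F : C(X, ℝ)) (q : X × ℝ) :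
    verticalShear F q = (q.1, q.2 + F q.1) :=
  rfl

theorem homotopicToId_verticalShear {X : Type*} [TopologicalSpace X] [T2Space X] (F : C(X, ℝ)) :
    HomotopicToId (verticalShear F).onePointCongr := by
  refine homotopicToId_onePointCongr_of_leftInverse
    ⟨fun q => (q.2.1, q.2.2 + (1 - (q.1 : ℝ)) * F q.2.1), by fun_prop⟩
    ⟨fun q => (q.2.1, q.2.2 - (1 - (q.1 : ℝ)) * F q.2.1), by fun_prop⟩ ?_ ?_ ?_
  · simp
  · simp [verticalShear_apply]
  · simp

end AmbientMaps

section RisingEnds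

theorem not_isLocalMax_of_eventually_lt {X : Type*} [TopologicalSpace X] {f : X → ℝ} {x : X}
    {l : Filter X} [l.NeBot] (hl : l ≤ 𝓝 x) (h : ∀ᶠ y in l, f x < f y) : ¬IsLocalMax f x := by
  intro hmax
  obtain ⟨y, hlt, hle⟩ := (h.and (hmax.filter_mono hl)).exists
  exact hlt.not_ge hle

theorem eventually_cocompact_real {P : ℝ → Prop} :
    (∀ᶠ t in cocompact ℝ, P t) ↔ (∀ᶠ t in atTop, P t) ∧ ∀ᶠ t in atTop, P (-t) := by
  rw [cocompact_eq_atBot_atTop, eventually_sup, ← map_neg_atTop, eventually_map, and_comm]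

/-- A function that tends to infinity at `+∞` and is strictly increasing on a neighbourhood
of `+∞`. -/
def IsEventuallyRising (f : ℝ → ℝ) : Prop :=
  Tendsto f atTop atTop ∧ ∃ T, StrictMonoOn f (Set.Ici T)

namespace IsEventuallyRising

variable {f g : ℝ → ℝ}

theorem congr' (hf : IsEventuallyRising f) (hfg : f =ᶠ[atTop] g) : IsEventuallyRising g := by
  obtain ⟨hlim, T, hT⟩ := hf
  obtain ⟨S, hS⟩ := eventually_atTop.1 hfg
  refine ⟨hlim.congr' hfg, max S T, fun a ha b hb hab => ?_⟩
  rw [Set.mem_Ici, max_le_iff] at ha hb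
  rw [← hS a ha.1, ← hS b hb.1]
  exact hT ha.2 hb.2 hab

theorem add_const (hf : IsEventuallyRising f) (c : ℝ) : IsEventuallyRising fun t => f t + c :=
  ⟨tendsto_atTop_add_const_right _ c hf.1,
    hf.2.imp fun _ hT _ ha _ hb hab => add_lt_add_left (hT ha hb hab) c⟩

theorem eventually_not_isLocalMax (hf : IsEventuallyRising f) :
    ∀ᶠ t in atTop, ¬IsLocalMax f t := by
  obtain ⟨-, T, hT⟩ := hf
  filter_upwards [eventually_ge_atTop T] with t ht
  refine not_isLocalMax_of_eventually_lt (l := 𝓝[>] t) nhdsWithin_le_nhds ?_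
  filter_upwards [self_mem_nhdsWithin] with x hx
  exact hT ht (ht.trans (le_of_lt hx)) hx

theorem exists_inverse (hf : IsEventuallyRising f) (hc : Continuous f) :
    ∃ p : C(ℝ, ℝ), Tendsto p atTop atTop ∧ (∀ᶠ t in atTop, p (f t) = t) ∧
      ∀ᶠ z in atTop, f (p z) = z := by
  obtain ⟨hlim, T, hT⟩ := hf
  let F : ℝ → ℝ := fun t => f (max t T) + min (t - T) 0
  have hF_top : F =ᶠ[atTop] f := by
    filter_upwards [eventually_ge_atTop T] with t ht
    simp [F, ht]
  have hF_bot : F =ᶠ[atBot] fun t => f T + (t - T) := by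
    filter_upwards [eventually_le_atBot T] with t ht
    simp [F, ht]
  have hF_mono : StrictMono F := by
    intro a b hab
    rcases le_or_gt b T with hb | hb
    · simp only [F, max_eq_right hb, max_eq_right (hab.le.trans hb), min_eq_left (sub_nonpos.2 hb),
        min_eq_left (sub_nonpos.2 (hab.le.trans hb))]
      linarith
    · have hlt : f (max a T) < f (max b T) :=
        hT (Set.mem_Ici.2 (le_max_right _ _)) (Set.mem_Ici.2 (le_max_right _ _)) (by simp [hab, hb])
      have hle : min (a - T) 0 ≤ min (b - T) 0 := by gcongr
      exact add_lt_add_of_lt_of_le hlt hle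
  have hF_surj : Function.Surjective F := by
    refine Continuous.surjective (by fun_prop) (hlim.congr' hF_top.symm) ?_
    exact (tendsto_atBot_add_const_left _ _
      (tendsto_atBot_add_const_right _ _ tendsto_id)).congr' hF_bot.symm
  let e : ℝ ≃o ℝ := hF_mono.orderIsoOfSurjective F hF_surj
  refine ⟨⟨e.symm, e.symm.continuous⟩, e.symm.tendsto_atTop, ?_, ?_⟩
  · filter_upwards [hF_top] with t ht
    rw [← ht]
    exact e.symm_apply_apply t
  · filter_upwards [e.symm.tendsto_atTop.eventually hF_top] with z hz
    exact hz.symm.trans (e.apply_symm_apply z)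

end IsEventuallyRising

end RisingEnds

section Closing

/-- The number (possibly infinite) of local maxima of a function. -/
def localMaxCount {X : Type*} [TopologicalSpace X] (f : X → ℝ) : ℕ∞ :=
  {x | IsLocalMax f x}.encard

theorem localMaxCount_le {X : Type*} [TopologicalSpace X] {f g : X → ℝ}
    (h : ∀ x, ¬IsLocalMax f x ∨ f =ᶠ[𝓝 x] g) : localMaxCount f ≤ localMaxCount g :=
  Set.encard_le_encard fun x hx => hx.congr ((h x).resolve_left (not_not_intro hx))

theorem isLocalMax_const_mul_iff {X : Type*} [TopologicalSpace X] {f : X → ℝ} {x : X} {a : ℝ}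
    (ha : 0 < a) : IsLocalMax (fun y => a * f y) x ↔ IsLocalMax f x := by
  simp only [IsLocalMax, IsMaxFilter, mul_le_mul_iff_right₀ ha]

theorem localMaxCount_const_mul {X : Type*} [TopologicalSpace X] (f : X → ℝ) {a : ℝ}
    (ha : 0 < a) : localMaxCount (fun x => a * f x) = localMaxCount f := by
  simp only [localMaxCount, isLocalMax_const_mul_iff ha]

variable {E : Type*} [NormedAddCommGroup E]

/-- The curve `γ`, completed by the point at infinity, can be moved into `E × ℝ` by a homeomorphism
homotopic to the identity, in such a way that its height has at most `N` local maxima. -/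
def HasClosing {X : Type*} [TopologicalSpace X] (γ : X → E × ℝ) (N : ℕ∞) : Prop :=
  ∃ G : OnePoint (E × ℝ) ≃ₜ OnePoint (E × ℝ), HomotopicToId G ∧ ∃ η : OnePoint X → E × ℝ,
    (∀ s, (η s : OnePoint (E × ℝ)) = G (OnePoint.map γ s)) ∧
      localMaxCount (fun s => (η s).2) ≤ N

section

variable {X : Type*} [TopologicalSpace X] {γ : X → E × ℝ}

theorem HasClosing.mono {M N : ℕ∞} (h : HasClosing γ M) (hMN : M ≤ N) : HasClosing γ N := by
  obtain ⟨G, hG, η, hη, hM⟩ := h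
  exact ⟨G, hG, η, hη, hM.trans hMN⟩

theorem HasClosing.of_comp {N : ℕ∞} {H : E × ℝ ≃ₜ E × ℝ} (hH : HomotopicToId H.onePointCongr)
    (h : HasClosing (H ∘ γ) N) : HasClosing γ N := by
  obtain ⟨G, hG, η, hη, hN⟩ := h
  refine ⟨H.onePointCongr.trans G, hH.trans hG, η, fun s => ?_, hN⟩
  rw [hη s]
  induction s using OnePoint.rec <;> rfl

theorem norm_zero_half_lt_one : ‖((0, 1 / 2) : E × ℝ)‖ < 1 := by
  rw [Prod.norm_mk]; norm_num

theorem norm_eq_snd {q : E × ℝ} (hq : ‖q.1‖ = q.2) : ‖q‖ = q.2 := by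
  rw [Prod.norm_def, hq, Real.norm_of_nonneg (hq ▸ norm_nonneg _), max_self]

variable [NormedSpace ℝ E] [ProperSpace E]

/-- Since `E × ℝ` carries the maximum norm, diagonal points have norm equal to their height; on them
dragging is the increasing function `z ↦ 2 z / (z + 1)` of the height `z`. -/
theorem dragInfinity_diagonal {q : E × ℝ} (hq : ‖q.1‖ = q.2) (h1 : 1 ≤ ‖q‖) :
    ∃ y : E × ℝ, (y : OnePoint (E × ℝ)) = dragInfinity (norm_zero_half_lt_one (E := E)) q ∧
      y.2 = 2 * q.2 / (q.2 + 1) := by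
  have hnorm := norm_eq_snd hq
  obtain ⟨w, z⟩ := q
  simp only at hq hnorm ⊢
  rw [hnorm] at h1
  have hz0 : 0 < z := by linarith
  have hshift : ballShift ((0, 1 / 2) : E × ℝ) (unitInversion (w, z))
      = (z⁻¹ ^ 2 • w, (z + 1) / (2 * z)) := by
    rw [ballShift, norm_unitInversion, hnorm,
      max_eq_right (sub_nonneg.2 (inv_le_one_of_one_le₀ h1)), unitInversion, hnorm]
    ext1
    · simp
    · simp only [Prod.snd_add, Prod.smul_snd, smul_eq_mul]
      field_simp
      ring
  have hnorm_shift : ‖((z⁻¹ ^ 2 • w, (z + 1) / (2 * z)) : E × ℝ)‖ = (z + 1) / (2 * z) := by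
    rw [Prod.norm_mk, norm_smul, hq, Real.norm_of_nonneg (by positivity),
      Real.norm_of_nonneg (by positivity), max_eq_right]
    field_simp
    linarith
  refine ⟨unitInversion (z⁻¹ ^ 2 • w, (z + 1) / (2 * z)), ?_, ?_⟩
  · rw [dragInfinity_coe, hshift]
    · rw [← norm_pos_iff, hnorm]; exact hz0
    · rw [hshift, ← norm_pos_iff, hnorm_shift]; positivity
  · rw [unitInversion, hnorm_shift, Prod.smul_snd, smul_eq_mul]
    field_simp

omit [TopologicalSpace X] in
theorem exists_lift_dragInfinity (hdiag : ∀ t, 1 ≤ ‖γ t‖ → ‖(γ t).1‖ = (γ t).2) :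
    ∃ η : OnePoint X → E × ℝ,
      (∀ s, (η s : OnePoint (E × ℝ))
        = dragInfinity (norm_zero_half_lt_one (E := E)) (OnePoint.map γ s)) ∧
      (∀ t : X, ‖γ t‖ ≤ 1 → η t = γ t) ∧
      ∀ t : X, 1 ≤ ‖γ t‖ → (η t).2 = 2 * (γ t).2 / ((γ t).2 + 1) := by
  have hfinite (s : OnePoint X) : ∃ y : E × ℝ, (y : OnePoint (E × ℝ))
      = dragInfinity (norm_zero_half_lt_one (E := E)) (OnePoint.map γ s) := by
    induction s using OnePoint.rec with
    | infty => exact ⟨_, (dragInfinity_infty norm_zero_half_lt_one (by simp)).symm⟩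
    | coe t =>
      rcases le_total ‖γ t‖ 1 with ht | ht
      · exact ⟨γ t, (dragInfinity_of_norm_le_one norm_zero_half_lt_one ht).symm⟩
      · exact (dragInfinity_diagonal (hdiag t ht) ht).imp fun _ hy => hy.1
  choose η hη using hfinite
  refine ⟨η, hη, fun t ht => ?_, fun t ht => ?_⟩
  · exact OnePoint.coe_injective ((hη t).trans (dragInfinity_of_norm_le_one _ ht))
  · obtain ⟨y, hy, hy_snd⟩ := dragInfinity_diagonal (hdiag t ht) ht
    rw [OnePoint.coe_injective ((hη t).trans hy.symm), hy_snd]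

theorem hasClosing_of_diagonal_outside_ball (hγ : Continuous γ)
    (hdiag : ∀ t, 1 ≤ ‖γ t‖ → ‖(γ t).1‖ = (γ t).2)
    (hmax : ∀ t, 1 ≤ ‖γ t‖ → ¬IsLocalMax (fun t => (γ t).2) t) :
    HasClosing γ (localMaxCount (fun t => (γ t).2) + 1) := by
  obtain ⟨η, hη, hη_inside, hη_outside⟩ := exists_lift_dragInfinity hdiag
  have hη_max : {s | IsLocalMax (fun s => (η s).2) s} ⊆
      insert OnePoint.infty ((↑) '' {t | IsLocalMax (fun t => (γ t).2) t}) := by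
    intro s hs
    induction s using OnePoint.rec with
    | infty => exact Set.mem_insert _ _
    | coe t =>
      have ht : IsLocalMax (fun t : X => (η t).2) t :=
        OnePoint.continuous_coe.continuousAt.eventually hs
      refine Set.mem_insert_of_mem _ ⟨t, ?_, rfl⟩
      rcases lt_or_ge ‖γ t‖ 1 with hlt | hge
      · refine ht.congr ?_
        filter_upwards [(isOpen_lt hγ.norm continuous_const).mem_nhds hlt] with x hx
        rw [hη_inside x (le_of_lt hx)]
      · refine absurd ?_ (hmax t hge)
        filter_upwards [ht] with x hx
        by_contra! hlt
        have h1 : 1 ≤ (γ t).2 := norm_eq_snd (hdiag t hge) ▸ hge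
        have hgex : 1 ≤ ‖γ x‖ := by
          have := (le_abs_self _).trans (norm_snd_le (γ x))
          linarith
        rw [hη_outside t hge, hη_outside x hgex, div_le_div_iff₀ (by linarith) (by linarith)] at hx
        linarith
  refine ⟨_, homotopicToId_dragInfinity norm_zero_half_lt_one, η, hη, ?_⟩
  refine (Set.encard_le_encard hη_max).trans ((Set.encard_insert_le _ _).trans ?_)
  gcongr
  exact Set.encard_image_le _ _

theorem hasClosing_of_eventually_diagonal (hγ : Continuous γ)
    (hdiag : ∀ᶠ t in cocompact X, ‖(γ t).1‖ = (γ t).2)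
    (hmax : ∀ᶠ t in cocompact X, ¬IsLocalMax (fun t => (γ t).2) t) :
    HasClosing γ (localMaxCount (fun t => (γ t).2) + 1) := by
  obtain ⟨K, hK, hKc⟩ := mem_cocompact.1 (hdiag.and hmax)
  obtain ⟨C, hC⟩ := hK.exists_bound_of_continuousOn hγ.continuousOn
  set a : ℝ := (max C 0 + 1)⁻¹ with ha_def
  have ha : 0 < a := by positivity
  have houtside (t : X) (ht : 1 ≤ ‖a • γ t‖) : t ∈ Kᶜ := by
    intro htK
    rw [norm_smul, Real.norm_of_nonneg ha.le, ha_def, inv_mul_eq_div,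
      one_le_div₀ (by positivity)] at ht
    linarith [hC t htK, le_max_left C 0]
  refine HasClosing.of_comp (homotopicToId_smul ha) ?_
  rw [← localMaxCount_const_mul _ ha]
  refine hasClosing_of_diagonal_outside_ball (hγ.const_smul a) (fun t ht => ?_) fun t ht => ?_
  · change ‖a • (γ t).1‖ = a * (γ t).2
    rw [norm_smul, Real.norm_of_nonneg ha.le, (hKc (houtside t ht)).1]
  · change ¬IsLocalMax (fun t => a * (γ t).2) t
    rw [isLocalMax_const_mul_iff ha]
    exact (hKc (houtside t ht)).2

end

theorem exists_slice_normalization [NormedSpace ℝ E] {a b : C(ℝ, E)} (hab : ∀ z, a z ≠ b z)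
    {r : C(ℝ, ℝ)} (hr : ∀ z, 0 < r z) :
    ∃ (m : C(ℝ, E)) (u : C(ℝ, ℝ)), (∀ z, 0 < u z) ∧
      ∀ z, ‖u z • (a z - m z)‖ = r z ∧ ‖u z • (b z - m z)‖ = r z := by
  have hdist (z : ℝ) : 0 < dist (a z) (b z) := dist_pos.2 (hab z)
  let m : C(ℝ, E) := ⟨fun z => midpoint ℝ (a z) (b z), by
    simp only [midpoint_eq_smul_add]
    fun_prop⟩
  let u : C(ℝ, ℝ) := ⟨fun z => 2 * r z / dist (a z) (b z),
    Continuous.div (by fun_prop) (by fun_prop) fun z => (hdist z).ne'⟩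
  have hu (z : ℝ) : 0 < u z := div_pos (mul_pos two_pos (hr z)) (hdist z)
  have hscale {w : E} {z : ℝ} (hw : ‖w‖ = dist (a z) (b z) / 2) : ‖u z • w‖ = r z := by
    have := (hdist z).ne'
    rw [norm_smul, Real.norm_of_nonneg (hu z).le, hw, ContinuousMap.coe_mk]
    field_simp
  have hhalf (x : ℝ) : ‖(2 : ℝ)‖⁻¹ * x = x / 2 := by rw [Real.norm_two, inv_mul_eq_div]
  refine ⟨m, u, hu, fun z => ⟨hscale ?_, hscale ?_⟩⟩ <;> rw [← dist_eq_norm]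
  · exact (dist_left_midpoint _ _).trans (hhalf _)
  · exact (dist_right_midpoint _ _).trans (hhalf _)

theorem exists_norm_lt_of_eventually_eq_zero {w : ℝ → E} (hw : Continuous w)
    (h0 : ∀ᶠ t in atTop, w t = 0) (T : ℝ) : ∃ R : ℝ, ∀ t ≥ T, ‖w t‖ < R := by
  obtain ⟨S, hS⟩ := eventually_atTop.1 h0
  obtain ⟨C, hC⟩ := isCompact_Icc.exists_bound_of_continuousOn (s := Set.Icc T S) hw.continuousOn
  refine ⟨max C 0 + 1, fun t ht => ?_⟩
  rcases le_total t S with hts | hts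
  · linarith [hC t ⟨ht, hts⟩, le_max_left C 0]
  · rw [hS t hts, norm_zero]
    positivity

section

variable [NormedSpace ℝ E] [ProperSpace E] {γ : ℝ → E × ℝ}

theorem hasClosing_of_rising_of_rising (hγ : Continuous γ) (hinj : Function.Injective γ)
    (hp : IsEventuallyRising fun t => (γ t).2) (hn : IsEventuallyRising fun t => (γ (-t)).2) :
    HasClosing γ (localMaxCount (fun t => (γ t).2) + 1) := by
  obtain ⟨p, hp_lim, hp_left, hp_right⟩ := hp.exists_inverse (by fun_prop)
  obtain ⟨n, hn_lim, hn_left, hn_right⟩ := hn.exists_inverse (by fun_prop)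
  have hdistinct : ∀ᶠ z in atTop, 0 < z ∧ (γ (p z)).1 ≠ (γ (-n z)).1 := by
    filter_upwards [hp_right, hn_right, hp_lim.eventually_gt_atTop 0, hn_lim.eventually_gt_atTop 0,
      eventually_gt_atTop 0] with z hpz hnz hp0 hn0 hz
    refine ⟨hz, fun heq => ?_⟩
    have := hinj (Prod.ext heq (hpz.trans hnz.symm))
    linarith
  obtain ⟨Z, hZ⟩ := eventually_atTop.1 hdistinct
  obtain ⟨m, u, hu, hnorm⟩ := exists_slice_normalization
    (a := ⟨fun z => (γ (p (max z Z))).1, by fun_prop⟩)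
    (b := ⟨fun z => (γ (-n (max z Z))).1, by fun_prop⟩) (r := ⟨fun z => max z Z, by fun_prop⟩)
    (fun z => (hZ _ (le_max_right z Z)).2) fun z => (hZ _ (le_max_right z Z)).1
  simp only [ContinuousMap.coe_mk] at hnorm
  refine HasClosing.of_comp (homotopicToId_sliceAffine m u hu) ?_
  refine hasClosing_of_eventually_diagonal ((sliceAffine m u hu).continuous.comp hγ)
    (eventually_cocompact_real.2 ⟨?_, ?_⟩) (eventually_cocompact_real.2 ⟨?_, ?_⟩)
  · filter_upwards [hp_left, hp.1.eventually_ge_atTop Z] with t ht hz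
    have := (hnorm (γ t).2).1
    rwa [max_eq_left hz, ht] at this
  · filter_upwards [hn_left, hn.1.eventually_ge_atTop Z] with t ht hz
    have := (hnorm (γ (-t)).2).2
    rwa [max_eq_left hz, ht] at this
  · exact hp.eventually_not_isLocalMax
  · filter_upwards [hn.eventually_not_isLocalMax] with t ht hmax
    exact ht (continuous_neg.continuousAt.eventually hmax)

theorem localMaxCount_add_two_mul_max_le {h r : ℝ → ℝ} (hr : Continuous r) {R T : ℝ}
    (hR : ∀ t ≥ -T, r t < R) (hdiag : ∀ t ≥ T, r (-t) = -h (-t))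
    (hmono : StrictMonoOn (fun t => -h (-t)) (Set.Ici T)) :
    localMaxCount (fun t => h t + 2 * max 0 (r t - R)) ≤ localMaxCount h := by
  refine localMaxCount_le fun t => ?_
  rcases lt_or_ge (r t) R with hlt | hge
  · right
    filter_upwards [(isOpen_lt hr continuous_const).mem_nhds hlt] with x hx
    rw [max_eq_left (sub_nonpos.2 (le_of_lt hx)), mul_zero, add_zero]
  · left
    obtain ⟨s, rfl⟩ : ∃ s, t = -s := ⟨-t, (neg_neg t).symm⟩
    have hs : T ≤ s := by
      by_contra! hsT
      exact (hR (-s) (neg_le_neg hsT.le)).not_ge hge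
    refine not_isLocalMax_of_eventually_lt (l := 𝓝[<] (-s)) nhdsWithin_le_nhds ?_
    filter_upwards [self_mem_nhdsWithin] with x hx
    obtain ⟨y, rfl⟩ : ∃ y, x = -y := ⟨-x, (neg_neg x).symm⟩
    have hsy : s < y := neg_lt_neg_iff.1 hx
    have hy : T ≤ y := hs.trans hsy.le
    have hlt : -h (-s) < -h (-y) := hmono hs hy hsy
    have hdiag_s := hdiag s hs
    have hdiag_y := hdiag y hy
    rw [max_eq_right (by linarith), max_eq_right (by linarith)]
    linarith

theorem hasClosing_of_eventually_axial_of_eventually_diagonal (hγ : Continuous γ)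
    (hinj : Function.Injective γ) (hp : IsEventuallyRising fun t => (γ t).2)
    (hn : IsEventuallyRising fun t => -(γ (-t)).2) (htop : ∀ᶠ t in atTop, (γ t).1 = 0)
    (hbot : ∀ᶠ t in atTop, ‖(γ (-t)).1‖ = -(γ (-t)).2) :
    HasClosing γ (localMaxCount (fun t => (γ t).2) + 1) := by
  obtain ⟨T, hdiag, hmono⟩ : ∃ T, (∀ t ≥ T, ‖(γ (-t)).1‖ = -(γ (-t)).2) ∧
      StrictMonoOn (fun t => -(γ (-t)).2) (Set.Ici T) := by
    obtain ⟨T₁, hT₁⟩ := eventually_atTop.1 hbot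
    obtain ⟨T₂, hT₂⟩ := hn.2
    exact ⟨max T₁ T₂, fun t ht => hT₁ t ((le_max_left _ _).trans ht),
      hT₂.mono (Set.Ici_subset_Ici.2 (le_max_right _ _))⟩
  obtain ⟨R, hR⟩ := exists_norm_lt_of_eventually_eq_zero (by fun_prop) htop (-T)
  obtain ⟨F, hF⟩ : ∃ F : C(E, ℝ), ∀ w, F w = 2 * max 0 (‖w‖ - R) :=
    ⟨⟨fun w => 2 * max 0 (‖w‖ - R), by fun_prop⟩, fun _ => rfl⟩
  -- Where `‖w‖ = -z ≥ R`, the shear by `F` sends `z` to `-z - 2 * R`: the falling end now rises.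
  refine HasClosing.of_comp (homotopicToId_verticalShear F) ?_
  refine (hasClosing_of_rising_of_rising ((verticalShear F).continuous.comp hγ)
    ((verticalShear F).injective.comp hinj) (hp.congr' ?_)
    ((hn.add_const (-(2 * R))).congr' ?_)).mono (add_le_add_left ?_ 1)
  · filter_upwards [eventually_ge_atTop (-T)] with t ht
    change (γ t).2 = (γ t).2 + F (γ t).1
    rw [hF, max_eq_left (sub_nonpos.2 (hR t ht).le), mul_zero, add_zero]
  · filter_upwards [eventually_ge_atTop T, hn.1.eventually_ge_atTop R] with t ht hRt
    change -(γ (-t)).2 + -(2 * R) = (γ (-t)).2 + F (γ (-t)).1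
    rw [hF, hdiag t ht, max_eq_right (by linarith)]
    ring
  · change localMaxCount (fun t => (γ t).2 + F (γ t).1) ≤ _
    simp only [hF]
    exact localMaxCount_add_two_mul_max_le hγ.fst.norm hR hdiag hmono

theorem hasClosing_of_falling_of_rising [Nontrivial E] (hγ : Continuous γ)
    (hinj : Function.Injective γ) (hp : IsEventuallyRising fun t => (γ t).2)
    (hn : IsEventuallyRising fun t => -(γ (-t)).2) :
    HasClosing γ (localMaxCount (fun t => (γ t).2) + 1) := by
  obtain ⟨p, -, hp_left, -⟩ := hp.exists_inverse (by fun_prop)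
  obtain ⟨n, -, hn_left, -⟩ := hn.exists_inverse (by fun_prop)
  obtain ⟨e, he⟩ := exists_norm_eq E zero_le_one
  let l : ℝ → ℝ := fun z => max 0 (min 1 z)
  -- Subtracting `m z` sends the rising end to the axis and the falling end to `(-z • e, z)`.
  let m : C(ℝ, E) :=
    ⟨fun z => l z • (γ (p z)).1 + (1 - l z) • ((γ (-n (-z))).1 + z • e), by fun_prop⟩
  have hm (z : ℝ) : m z = l z • (γ (p z)).1 + (1 - l z) • ((γ (-n (-z))).1 + z • e) := rfl
  obtain ⟨S, hS, hS_id⟩ : ∃ S : E × ℝ ≃ₜ E × ℝ, (∀ q, S q = (q.1 - m q.2, q.2)) ∧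
      HomotopicToId S.onePointCongr :=
    ⟨_, fun q => (sliceAffine_apply m 1 _ q).trans (by simp),
      homotopicToId_sliceAffine m 1 fun _ => one_pos⟩
  have hsnd (t : ℝ) : (S (γ t)).2 = (γ t).2 := by rw [hS]
  refine HasClosing.of_comp hS_id ?_
  simp only [← hsnd]
  refine hasClosing_of_eventually_axial_of_eventually_diagonal
    (S.continuous.comp hγ) (S.injective.comp hinj) (by simpa only [Function.comp_apply, hsnd])
    (by simpa only [Function.comp_apply, hsnd]) ?_ ?_
  · filter_upwards [hp_left, hp.1.eventually_ge_atTop 1] with t ht h1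
    have hl : l (γ t).2 = 1 := by simp [l, h1]
    simp [hS, hm, hl, ht]
  · filter_upwards [hn_left, hn.1.eventually_ge_atTop 0] with t ht h0
    have hl : l (γ (-t)).2 = 0 := by simpa [l] using Or.inr (neg_nonneg.1 h0)
    simp [hS, hm, hl, ht, norm_smul, he, abs_of_nonpos (neg_nonneg.1 h0)]

end

section

variable [NormedSpace ℝ E] [ProperSpace E] [Nontrivial E] {γ : ℝ → E × ℝ}

theorem hasClosing_one_of_isClosedEmbedding_fst (hγ : Continuous γ)
    (hfst : IsClosedEmbedding fun t => (γ t).1) : HasClosing γ 1 := by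
  obtain ⟨F, hF⟩ := ContinuousMap.exists_extension hfst
    (⟨fun t => t - (γ t).2, by fun_prop⟩ : C(ℝ, ℝ))
  have hF_apply (t : ℝ) : F (γ t).1 = t - (γ t).2 := DFunLike.congr_fun hF t
  have hheight (t : ℝ) : ((verticalShear F ∘ γ) t).2 = t := by
    simp [verticalShear_apply, hF_apply]
  have hrise : IsEventuallyRising id := ⟨tendsto_id, 0, strictMono_id.strictMonoOn _⟩
  have hcount : localMaxCount (id : ℝ → ℝ) = 0 := by
    refine Set.encard_eq_zero.2 (Set.eq_empty_of_forall_notMem fun t => ?_)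
    exact not_isLocalMax_of_eventually_lt (l := 𝓝[>] t) nhdsWithin_le_nhds self_mem_nhdsWithin
  have hinj : Function.Injective γ := .of_comp hfst.injective
  refine HasClosing.of_comp (homotopicToId_verticalShear F) ?_
  refine (hasClosing_of_falling_of_rising ((verticalShear F).continuous.comp hγ)
    ((verticalShear F).injective.comp hinj) ?_ ?_).mono ?_ <;> simp only [hheight, neg_neg]
  · exact hrise
  · exact hrise
  · exact (congrArg (· + 1) hcount).le.trans (zero_add 1).le

theorem hasClosing_one_of_constant_height (hγ : IsClosedEmbedding γ) {a : ℝ}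
    (ha : ∀ t, (γ t).2 = a) : HasClosing γ 1 := by
  have hslice : IsClosedEmbedding fun w : E => (w, a) := by
    refine ⟨isEmbedding_prodMkLeft a, ?_⟩
    have : Set.range (fun w : E => (w, a)) = Prod.snd ⁻¹' {a} := by
      ext ⟨w, b⟩
      simp [eq_comm]
    rw [this]
    exact isClosed_singleton.preimage continuous_snd
  refine hasClosing_one_of_isClosedEmbedding_fst hγ.continuous (hslice.of_comp_iff.1 ?_)
  convert hγ using 1
  exact funext fun t => Prod.ext rfl (ha t).symm

end

end Closing

section PolynomialHeight

theorem exists_isLocalMin_Ioo {f : ℝ → ℝ} {a b : ℝ} (hab : a < b)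
    (hf : ContinuousOn f (Set.Icc a b)) (ha : ∀ᶠ x in 𝓝[>] a, f x < f a)
    (hb : ∀ᶠ x in 𝓝[<] b, f x < f b) : ∃ c ∈ Set.Ioo a b, IsLocalMin f c := by
  obtain ⟨c, hc, hmin⟩ := isCompact_Icc.exists_isMinOn (Set.nonempty_Icc.2 hab.le) hf
  have hca : a ≠ c := by
    rintro rfl
    obtain ⟨x, hlt, hx⟩ := (ha.and (Ioo_mem_nhdsGT hab)).exists
    exact (hmin (Set.Ioo_subset_Icc_self hx)).not_gt hlt
  have hcb : c ≠ b := by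
    rintro rfl
    obtain ⟨x, hlt, hx⟩ := (hb.and (Ioo_mem_nhdsLT hab)).exists
    exact (hmin (Set.Ioo_subset_Icc_self hx)).not_gt hlt
  have hc' : c ∈ Set.Ioo a b := ⟨hc.1.lt_of_ne hca, hc.2.lt_of_ne hcb⟩
  exact ⟨c, hc', hmin.isLocalMin (Icc_mem_nhds hc'.1 hc'.2)⟩

theorem two_mul_card_le_of_interleaved {α : Type*} [LinearOrder α] {s t : Finset α} {u : α}
    (hst : s ⊆ t) (hu : ∀ x ∈ s, x < u)
    (h : ∀ x ∈ s, ∀ y ∈ insert u s, x < y → ∃ z ∈ t, x < z ∧ z < y) : 2 * s.card ≤ t.card := by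
  have hinterleaved : (insert u s).card ≤ (t \ insert u s).card + 1 := by
    refine Finset.card_le_sdiff_of_interleaved fun x hx y hy hxy _ => ?_
    refine h x ((Finset.mem_insert.1 hx).resolve_left ?_) y hy hxy
    rintro rfl
    rcases Finset.mem_insert.1 hy with rfl | hy
    · exact hxy.false
    · exact hxy.not_gt (hu y hy)
  rw [Finset.card_insert_of_notMem fun hus => (hu u hus).false] at hinterleaved
  have hmono := Finset.card_le_card (Finset.sdiff_subset_sdiff (subset_refl t)
    (Finset.subset_insert u s))
  have hsdiff := Finset.card_sdiff_add_card_eq_card hst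
  omega

variable {P : ℝ[X]}

theorem eventually_eval_lt_of_isLocalMax (hP : 0 < P.natDegree) {s : ℝ}
    (hs : IsLocalMax P.eval s) : ∀ᶠ x in 𝓝[≠] s, P.eval x < P.eval s := by
  have hne : P - C (P.eval s) ≠ 0 := fun h =>
    hP.ne' (by rw [sub_eq_zero.1 h, natDegree_C])
  filter_upwards [hs.filter_mono nhdsWithin_le_nhds,
    nhdsNE_le_cofinite s (finite_setOfPred_isRoot hne).compl_mem_cofinite] with x hle hx
  exact hle.lt_of_ne fun h => hx (by simp [h])

theorem isEventuallyRising_eval (hP : 0 < P.natDegree) (hlead : 0 < P.leadingCoeff) :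
    IsEventuallyRising P.eval := by
  have hderiv_lead : 0 < P.derivative.leadingCoeff := by
    rw [leadingCoeff_derivative]
    positivity
  have hderiv : ∀ᶠ t in atTop, 0 < P.derivative.eval t := by
    rcases P.derivative.natDegree.eq_zero_or_pos with h | h
    · rw [eq_C_of_natDegree_eq_zero h]
      rw [leadingCoeff, h] at hderiv_lead
      simp [hderiv_lead]
    · exact (P.derivative.tendsto_atTop_of_leadingCoeff_nonneg (natDegree_pos_iff_degree_pos.1 h)
        hderiv_lead.le).eventually_gt_atTop 0
  obtain ⟨T, hT⟩ := eventually_atTop.1 hderiv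
  refine ⟨P.tendsto_atTop_of_leadingCoeff_nonneg (natDegree_pos_iff_degree_pos.1 hP) hlead.le, T,
    strictMonoOn_of_deriv_pos (convex_Ici T) P.continuous.continuousOn fun t ht => ?_⟩
  rw [interior_Ici] at ht
  simpa using hT t (le_of_lt ht)

theorem isEventuallyRising_eval_neg (hP : 0 < P.natDegree)
    (hlead : 0 < (-1) ^ P.natDegree * P.leadingCoeff) :
    IsEventuallyRising fun t => P.eval (-t) := by
  have hcomp : 0 < (P.comp (-X)).leadingCoeff := by
    simpa [leadingCoeff_comp, mul_comm] using hlead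
  simpa using isEventuallyRising_eval (by simpa [natDegree_comp] using hP) hcomp

theorem exists_localMaxCount_eval_eq (hP : 0 < P.natDegree) (hlead : 0 < P.leadingCoeff) :
    ∃ m : ℕ, localMaxCount P.eval = m ∧ 2 * m + 1 ≤ P.natDegree := by
  have hderiv : P.derivative ≠ 0 := fun h => hP.ne' (derivative_eq_zero.1 h)
  have hfin : {t | IsLocalMax P.eval t}.Finite :=
    (finite_setOfPred_isRoot hderiv).subset fun t ht => by simpa using ht.deriv_eq_zero
  obtain ⟨M, hM⟩ := hfin.exists_finset_coe
  have hM_mem {t : ℝ} : t ∈ M ↔ IsLocalMax P.eval t := by rw [← Finset.mem_coe, hM]; rfl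
  obtain ⟨-, T, hT⟩ := isEventuallyRising_eval hP hlead
  obtain ⟨u, huM, huT⟩ : ∃ u, (∀ t ∈ M, t < u) ∧ T < u :=
    (((eventually_all_finset M).2 fun t _ => eventually_gt_atTop t).and
      (eventually_gt_atTop T)).exists
  -- The point `u` plays the part of `+∞`: it provides the local minimum after the last maximum.
  have hlt_left : ∀ y ∈ insert u M, ∀ᶠ x in 𝓝[<] y, P.eval x < P.eval y := by
    intro y hy
    rcases Finset.mem_insert.1 hy with rfl | hy
    · filter_upwards [Ioo_mem_nhdsLT huT] with x hx using hT hx.1.le huT.le hx.2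
    · exact (eventually_eval_lt_of_isLocalMax hP (hM_mem.1 hy)).filter_mono (nhdsLT_le_nhdsNE y)
  refine ⟨M.card, by rw [localMaxCount, ← hM, Set.encard_coe_eq_coe_finsetCard], ?_⟩
  have hcard : 2 * M.card ≤ P.derivative.roots.toFinset.card := by
    refine two_mul_card_le_of_interleaved (fun t ht => ?_) huM fun x hx y hy hxy => ?_
    · simpa [hderiv] using (hM_mem.1 ht).deriv_eq_zero
    · obtain ⟨c, hc, hmin⟩ := exists_isLocalMin_Ioo hxy P.continuousOn
        ((eventually_eval_lt_of_isLocalMax hP (hM_mem.1 hx)).filter_mono (nhdsGT_le_nhdsNE x))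
        (hlt_left y hy)
      exact ⟨c, by simpa [hderiv] using hmin.deriv_eq_zero, hc⟩
  have hroots := (Multiset.toFinset_card_le P.derivative.roots).trans (card_roots' _)
  have hdegree := natDegree_derivative_lt hP.ne'
  omega

variable {E : Type*} [NormedAddCommGroup E] [NormedSpace ℝ E] [ProperSpace E] [Nontrivial E]
  {γ : ℝ → E × ℝ}

theorem hasClosing_of_polynomial_height (hγ : Continuous γ) (hinj : Function.Injective γ)
    (hγP : ∀ t, (γ t).2 = P.eval t) (hP : 0 < P.natDegree) (hlead : 0 < P.leadingCoeff) :
    HasClosing γ (localMaxCount P.eval + 1) := by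
  have hp := isEventuallyRising_eval hP hlead
  simp only [← hγP] at hp ⊢
  rcases P.natDegree.even_or_odd with heven | hodd
  · refine hasClosing_of_rising_of_rising hγ hinj hp ?_
    simp only [hγP]
    exact isEventuallyRising_eval_neg hP (by rwa [heven.neg_one_pow, one_mul])
  · refine hasClosing_of_falling_of_rising hγ hinj hp ?_
    simp only [hγP, ← eval_neg]
    refine isEventuallyRising_eval_neg (by rwa [natDegree_neg]) ?_
    rwa [natDegree_neg, hodd.neg_one_pow, leadingCoeff_neg, neg_mul_neg, one_mul]

theorem exists_hasClosing_of_polynomial_height (hγ : IsClosedEmbedding γ)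
    (hγP : ∀ t, (γ t).2 = P.eval t) (hlead : 0 ≤ P.leadingCoeff) :
    ∃ N : ℕ, HasClosing γ N ∧ 2 * N ≤ max 2 (P.natDegree + 1) := by
  rcases P.natDegree.eq_zero_or_pos with h0 | hP
  · refine ⟨1, ?_, le_max_left _ _⟩
    rw [eq_C_of_natDegree_eq_zero h0] at hγP
    exact hasClosing_one_of_constant_height hγ fun t => (hγP t).trans eval_C
  · have hlead_pos : 0 < P.leadingCoeff :=
      hlead.lt_of_ne' (leadingCoeff_ne_zero.2 (ne_zero_of_natDegree_gt hP))
    obtain ⟨m, hm, hm_le⟩ := exists_localMaxCount_eval_eq hP hlead_pos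
    refine ⟨m + 1, ?_, by omega⟩
    rw [Nat.cast_add_one, ← hm]
    exact hasClosing_of_polynomial_height hγ.continuous hγ.injective hγP hP hlead_pos

end PolynomialHeight

section HeightPolynomials

variable {n : ℕ} (p : Fin n → ℝ[X])

/-- The height of the curve with components `p` in the direction `v`, as a polynomial in the
parameter that depends linearly on `v`. -/
def heightPoly : EucSpace n →ₗ[ℝ] ℝ[X] :=
  Fintype.linearCombination ℝ p ∘ₗ (WithLp.linearEquiv 2 ℝ (Fin n → ℝ)).toLinearMap

theorem heightPoly_apply (v : EucSpace n) : heightPoly p v = ∑ i, v i • p i :=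
  rfl

theorem eval_heightPoly (v : EucSpace n) (t : ℝ) :
    (heightPoly p v).eval t = inner ℝ v (polyCurve p t) := by
  simp [heightPoly_apply, polyCurve, eval_finsetSum, PiLp.inner_apply, mul_comm]

variable {p}

theorem exists_natDegree_heightPoly_le {k d : ℕ} (hk : k < n) (hd : ∀ i, (p i).natDegree ≤ d) :
    ∃ v ≠ 0, (heightPoly p v).natDegree ≤ d - k := by
  let topCoeffs : EucSpace n →ₗ[ℝ] Fin k → ℝ :=
    LinearMap.pi fun j => lcoeff ℝ (d - j) ∘ₗ heightPoly p
  obtain ⟨v, hv, hv0⟩ := Submodule.exists_mem_ne_zero_of_ne_bot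
    (LinearMap.ker_ne_bot_of_finrank_lt (f := topCoeffs) (by simpa))
  refine ⟨v, hv0, natDegree_le_iff_coeff_eq_zero.2 fun m hm => ?_⟩
  rcases lt_or_ge d m with hdm | hmd
  · rw [heightPoly_apply, finsetSum_coeff]
    refine Finset.sum_eq_zero fun i _ => ?_
    rw [coeff_smul, coeff_eq_zero_of_natDegree_lt ((hd i).trans_lt hdm), smul_zero]
  · have hcoeff : (heightPoly p v).coeff (d - (d - m)) = 0 :=
      congrFun hv (⟨d - m, by omega⟩ : Fin k)
    rwa [Nat.sub_sub_self hmd] at hcoeff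

theorem exists_natDegree_heightPoly_le_of_leadingCoeff_nonneg {k d : ℕ} (hk : k < n)
    (hd : ∀ i, (p i).natDegree ≤ d) :
    ∃ v ≠ 0, (heightPoly p v).natDegree ≤ d - k ∧ 0 ≤ (heightPoly p v).leadingCoeff := by
  obtain ⟨v, hv, hdeg⟩ := exists_natDegree_heightPoly_le hk hd
  rcases le_total 0 (heightPoly p v).leadingCoeff with hlead | hlead
  · exact ⟨v, hv, hdeg, hlead⟩
  · refine ⟨-v, neg_ne_zero.2 hv, ?_, ?_⟩
    · rwa [map_neg, natDegree_neg]
    · rwa [map_neg, leadingCoeff_neg, neg_nonneg]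

end HeightPolynomials

section BridgeNumber

theorem exists_equiv_ker_prod_snd_eq {V : Type*} [NormedAddCommGroup V] [InnerProductSpace ℝ V]
    {v : V} (hv : v ≠ 0) :
    ∃ L : V ≃L[ℝ] (innerSL ℝ v).ker × ℝ, ∀ x, (L x).2 = inner ℝ v x := by
  let r : ℝ →L[ℝ] V := ContinuousLinearMap.toSpanSingleton ℝ ((‖v‖ ^ 2)⁻¹ • v)
  have hr : Function.RightInverse r (innerSL ℝ v) := fun x => by
    simp [r, hv]
  exact ⟨(ContinuousLinearEquiv.equivOfRightInverse _ r hr).trans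
    (ContinuousLinearEquiv.prodComm ℝ ℝ _), fun x => rfl⟩

theorem PolyKnot.isClosedEmbedding {n : ℕ} (κ : PolyKnot n) :
    IsClosedEmbedding (polyCurve κ.comp) :=
  .of_continuous_injective_isClosedMap κ.isEmbedding.continuous κ.isEmbedding.injective
    (isProperMap_iff_tendsto_cocompact.2
      ⟨κ.isEmbedding.continuous, κ.tendsto_cocompact⟩).isClosedMap

theorem PolyKnot.bridgeNumber_le_of_hasClosing (κ : PolyKnot 3) {v : EucSpace 3} (hv : v ≠ 0)
    {E : Type*} [NormedAddCommGroup E] [NormedSpace ℝ E] {L : EucSpace 3 ≃L[ℝ] E × ℝ}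
    (hL : ∀ x, (L x).2 = inner ℝ v x) {N : ℕ∞} (h : HasClosing (L ∘ polyCurve κ.comp) N) :
    κ.completion.bridgeNumber ≤ N := by
  obtain ⟨G, hG, η, hη, hN⟩ := h
  let e : SphereOf 3 ≃ₜ OnePoint (E × ℝ) := L.toHomeomorph.onePointCongr
  let g : SphereOf 3 ≃ₜ SphereOf 3 := (e.trans G).trans e.symm
  have hg (s : CircleOf) :
      ((L.symm (η s) : EucSpace 3) : SphereOf 3) = g (κ.completion.toFun s) := by
    have he : e (κ.completion.toFun s) = OnePoint.map (L ∘ polyCurve κ.comp) s := by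
      induction s using OnePoint.rec <;> rfl
    simp only [g, Homeomorph.trans_apply]
    rw [he, ← hη s, Homeomorph.eq_symm_apply]
    exact congrArg _ (L.apply_symm_apply (η s))
  let K' : SpaceKnot 3 :=
    { toFun := fun s => L.symm (η s)
      isEmbedding := by
        rw [← (OnePoint.isOpenEmbedding_coe (X := EucSpace 3)).isEmbedding.of_comp_iff]
        have hcomp : ((↑) : EucSpace 3 → SphereOf 3) ∘ (fun s => L.symm (η s)) =
            g ∘ κ.completion.toFun := funext hg
        rw [hcomp]
        exact g.isEmbedding.comp κ.completion.isEmbedding }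
  have hK' : K'.toTopKnot.Equivalent κ.completion :=
    ⟨Homeomorph.refl _, g, homotopicToId_refl.isOrientationPreserving 1,
      (hG.conj e).isOrientationPreserving 3, funext hg⟩
  have hheight (s : CircleOf) : inner ℝ v (K'.toFun s) = (η s).2 := by
    rw [← hL]
    exact congrArg Prod.snd (L.apply_symm_apply (η s))
  refine iInf₂_le_of_le K' hK' (iInf₂_le_of_le v hv ?_)
  simpa only [SpaceKnot.numLocalMax, localMaxCount, hheight] using hN

theorem PolyKnot.exists_bridgeNumber_le (κ : PolyKnot 3) (hd : 3 ≤ κ.degree) :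
    ∃ N : ℕ, κ.completion.bridgeNumber ≤ N ∧ 2 * N + 1 ≤ κ.degree := by
  obtain ⟨v, hv, hdeg, hlead⟩ := exists_natDegree_heightPoly_le_of_leadingCoeff_nonneg
    (p := κ.comp) (k := 2) (by norm_num) fun i =>
      Finset.le_sup (f := fun i => (κ.comp i).natDegree) (Finset.mem_univ i)
  change (heightPoly κ.comp v).natDegree ≤ κ.degree - 2 at hdeg
  obtain ⟨L, hL⟩ := exists_equiv_ker_prod_snd_eq hv
  have hker : Nontrivial (innerSL ℝ v).ker :=
    Submodule.nontrivial_iff_ne_bot.2 (LinearMap.ker_ne_bot_of_finrank_lt (by simp))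
  obtain ⟨N, hN, hN_le⟩ := exists_hasClosing_of_polynomial_height
    (L.toHomeomorph.isClosedEmbedding.comp κ.isClosedEmbedding)
    (fun t => (hL _).trans (eval_heightPoly κ.comp v t).symm) hlead
  exact ⟨N, κ.bridgeNumber_le_of_hasClosing hv hL hN, by omega⟩

end BridgeNumber

end

theorem mainTheorem7 (κ : PolyKnot 3) (d : ℕ) (hd : κ.degree = d) (hd3 : 3 ≤ d) :
    ∃ b : ℕ, κ.completion.bridgeNumber = (b : ℕ∞) ∧ (b : ℝ) ≤ (1 / 2) * ((d : ℝ) - 1) := by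
  subst hd
  obtain ⟨N, hN, hN_le⟩ := κ.exists_bridgeNumber_le hd3
  obtain ⟨b, hb⟩ := ENat.ne_top_iff_exists.1 (ne_top_of_le_ne_top (ENat.natCast_ne_top N) hN)
  have hbN : b ≤ N := by rwa [← hb, Nat.cast_le] at hN
  have hb_le : 2 * (b : ℝ) + 1 ≤ κ.degree := by exact_mod_cast (by omega : 2 * b + 1 ≤ κ.degree)
  exact ⟨b, hb.symm, by linarith⟩
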